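/- A homomorphism of groups $c:X\to G$ is a cellular cover of $G$ if the map $\operatorname{Hom}(X,X)\to\operatorname{Hom}(X,G)$, $\varphi\mapsto c\varphi$, is a bijection. Two cellular covers $c:X\to G$ and $d:Y\to G$ are equivalent if $dh=c$ for some isomorphism $h:X\to Y$; let $\operatorname{SurCov}(G)$ be the collection of equivalence classes of surjective cellular covers of $G$. The kernel $K_c$ of a cellular cover $c$ is central in $X$, so a surjective cellular cover $c$ is a central extension of $G$ by $K_c$. Its differential $\mu(c):H_2(G)\to K_c$, where $H_2(G)=H_2(G;\mathbb Z)$, is the image of the class of this extension under the natural map $H^2(G,K_c)\to\operatorname{Hom}(H_2(G),K_c)$; explicitly, if $s:G\to X$ is a set-theoretic section of $c$, then $\mu(c)$ sends the class of a $2$-cycle $\sum_i n_i[g_i|h_i]$ to $\prod_i\bigl(s(g_i)s(h_i)s(g_ih_i)^{-1}\bigr)^{n_i}$. For an abelian group $A$, let $\operatorname{Quot}(A)$ be the set of equivalence classes of surjective homomorphisms out of $A$ onto abelian groups, where $\sigma:A\to K$ and $\tau:A\to L$ are equivalent if $h\sigma=\tau$ for some isomorphism $h:K\to L$. The group $\operatorname{Out}(G)$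 acts on $\operatorname{Quot}(H_2(G))$ on the right by $([\sigma],[h])\mapsto[\sigma\circ H_2(h)]$; let $\operatorname{InvQuot}(H_2(G))$ be the set of fixed points of this action. Theorem. Let $G$ be a finite simple group. Then, for every surjective cellular cover $c$ of $G$, the differential $\mu(c):H_2(G)\to K_c$ is surjective and its class $[\mu(c)]$ lies in $\operatorname{InvQuot}(H_2(G))$; this class depends only on the equivalence class of $c$, and the resulting map $$\mu:\operatorname{SurCov}(G)\to\operatorname{InvQuot}(H_2(G)),\qquad [c]\mapsto[\mu(c)],$$ is a bijection. -/

import Mathlib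

universe u

noncomputable section

namespace CellCover

open groupHomology

/-! ### Integral homology in degree two -/

/-- The trivial `G`-module of integers. Mathlib wants the coefficient ring and the group in the same
universe, hence the `ULift`. -/
abbrev trivZ (G : Type u) [Group G] : Rep.{u} (ULift.{u} ℤ) G :=
  Rep.trivial (ULift.{u} ℤ) G (ULift.{u} ℤ)

/-- The second integral homology group (Schur multiplier) `H₂(G)`. -/
abbrev Schur (G : Type u) [Group G] : Type u := groupHomology.H2 (trivZ G)

/-- The projection from `2`-cycles (in the inhomogeneous chains `ℤ[G × G]`) to `H₂(G)`. -/
def cyclesToSchur (G : Type u) [Group G] : cycles₂ (trivZ G) →+ Schur G :=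
  (H2π (trivZ G)).hom.toAddMonoidHom

theorem cyclesToSchur_surjective (G : Type u) [Group G] :
    Function.Surjective (cyclesToSchur G) :=
  (ModuleCat.epi_iff_surjective (H2π (trivZ G))).1 inferInstance

theorem cyclesToSchur_eq_zero_iff {G : Type u} [Group G] (z : cycles₂ (trivZ G)) :
    cyclesToSchur G z = 0 ↔ z.1 ∈ boundaries₂ (trivZ G) :=
  H2π_eq_zero_iff z

/-- The identity of `ℤ`, as a map of trivial modules along a group homomorphism. -/
def trivZHom {G H : Type u} [Group G] [Group H] (f : G →* H) :
    trivZ G ⟶ Rep.res f (trivZ H) :=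
  Rep.ofHom (Representation.IntertwiningMap.id (Representation.trivial (ULift.{u} ℤ) G (ULift.{u} ℤ)))

/-- The homomorphism `H₂(f) : H₂(G) → H₂(H)` induced by a group homomorphism `f : G → H`. -/
def Schur.map {G H : Type u} [Group G] [Group H] (f : G →* H) : Schur G →+ Schur H :=
  (groupHomology.map f (trivZHom f) 2).hom.toAddMonoidHom

theorem Schur.map_id (G : Type u) [Group G] : Schur.map (MonoidHom.id G) = AddMonoidHom.id _ := by
  have h : groupHomology.map (MonoidHom.id G) (trivZHom (MonoidHom.id G)) 2 =
      CategoryTheory.CategoryStruct.id _ :=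
    groupHomology.map_id (A := trivZ G) 2
  ext x
  simp only [Schur.map, h]
  rfl

theorem Schur.map_comp {G H L : Type u} [Group G] [Group H] [Group L] (g : H →* L) (f : G →* H) :
    Schur.map (g.comp f) = (Schur.map g).comp (Schur.map f) := by
  have h := groupHomology.map_comp f g (trivZHom f) (trivZHom g) 2
  ext x
  exact congrArg (fun φ => φ.hom x) h

/-- The homotopy between conjugation and the identity in degree two:
`[x|y] ↦ [t⁻¹|x'|y'] - [x|t⁻¹|y'] + [x|y|t⁻¹]` with `x' = t x t⁻¹`. -/
def conjHomotopy₂ {G : Type u} [Group G] (t : G) :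
    (G × G →₀ ULift.{u} ℤ) →ₗ[ULift.{u} ℤ] (G × G × G →₀ ULift.{u} ℤ) :=
  Finsupp.lsum (ULift.{u} ℤ) fun p =>
    Finsupp.lsingle (t⁻¹, t * p.1 * t⁻¹, t * p.2 * t⁻¹) -
      Finsupp.lsingle (p.1, t⁻¹, t * p.2 * t⁻¹) + Finsupp.lsingle (p.1, p.2, t⁻¹)

/-- The homotopy in degree one: `[x] ↦ [t⁻¹|x'] - [x|t⁻¹]`. -/
def conjHomotopy₁ {G : Type u} [Group G] (t : G) :
    (G →₀ ULift.{u} ℤ) →ₗ[ULift.{u} ℤ] (G × G →₀ ULift.{u} ℤ) :=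
  Finsupp.lsum (ULift.{u} ℤ) fun x =>
    Finsupp.lsingle (t⁻¹, t * x * t⁻¹) - Finsupp.lsingle (x, t⁻¹)

theorem conjHomotopy_eq {G : Type u} [Group G] (t : G) :
    (d₃₂ (trivZ G)).hom ∘ₗ conjHomotopy₂ t + conjHomotopy₁ t ∘ₗ (d₂₁ (trivZ G)).hom =
      (chainsMap₂ (MulAut.conj t).toMonoidHom (trivZHom (MulAut.conj t).toMonoidHom)).hom -
        LinearMap.id := by
  refine Finsupp.lhom_ext fun p a => ?_
  obtain ⟨x, y⟩ := p
  have e1 : t⁻¹ * (t * x * t⁻¹) = x * t⁻¹ := by group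
  have e2 : t⁻¹ * (t * y * t⁻¹) = y * t⁻¹ := by group
  have e3 : t * x * t⁻¹ * (t * y * t⁻¹) = t * (x * y) * t⁻¹ := by group
  have h2 : conjHomotopy₂ t (Finsupp.single (x, y) a) =
      Finsupp.single (t⁻¹, t * x * t⁻¹, t * y * t⁻¹) a -
        Finsupp.single (x, t⁻¹, t * y * t⁻¹) a + Finsupp.single (x, y, t⁻¹) a := by
    simp [conjHomotopy₂]
  have h1 : ∀ g : G, conjHomotopy₁ t (Finsupp.single g a) =
      Finsupp.single (t⁻¹, t * g * t⁻¹) a - Finsupp.single (g, t⁻¹) a := by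
    intro g
    simp [conjHomotopy₁]
  have h0 : (chainsMap₂ (MulAut.conj t).toMonoidHom
      (trivZHom (MulAut.conj t).toMonoidHom)).hom (Finsupp.single (x, y) a) =
        Finsupp.single (t * x * t⁻¹, t * y * t⁻¹) a := by
    simp [chainsMap₂, trivZHom]
    rfl
  have d3 : ∀ g : G × G × G, (d₃₂ (trivZ G)).hom (Finsupp.single g a) =
      Finsupp.single (g.2.1, g.2.2) a - Finsupp.single (g.1 * g.2.1, g.2.2) a +
      Finsupp.single (g.1, g.2.1 * g.2.2) a - Finsupp.single (g.1, g.2.1) a :=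
    fun g => d₃₂_single (A := trivZ G) g a
  have d2 : (d₂₁ (trivZ G)).hom (Finsupp.single (x, y) a) =
      Finsupp.single y a - Finsupp.single (x * y) a + Finsupp.single x a :=
    d₂₁_single (A := trivZ G) (x, y) a
  rw [LinearMap.add_apply, LinearMap.comp_apply, LinearMap.comp_apply, LinearMap.sub_apply, h0, h2,
    d2]
  simp only [map_add, map_sub, h1, d3, e1, e2, e3, LinearMap.id_apply]
  abel

/-- Inner automorphisms act trivially on `H₂`. -/
theorem Schur.map_conj {G : Type u} [Group G] (t : G) :
    Schur.map (MulAut.conj t).toMonoidHom = AddMonoidHom.id (Schur G) := by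
  ext x
  refine groupHomology.H2_induction_on x fun z => ?_
  set f : G →* G := (MulAut.conj t).toMonoidHom with hf
  have h : Schur.map f (H2π (trivZ G) z) = H2π (trivZ G) (mapCycles₂ f (trivZHom f) z) :=
    congrArg (fun φ => φ.hom z) (H2π_comp_map f (trivZHom f))
  rw [h, AddMonoidHom.id_apply]
  refine (H2π_eq_iff _ _).2 ⟨conjHomotopy₂ t z.1, ?_⟩
  have hz : (d₂₁ (trivZ G)).hom z.1 = 0 := z.2
  have := LinearMap.congr_fun (conjHomotopy_eq t) z.1
  rw [LinearMap.add_apply, LinearMap.comp_apply, LinearMap.comp_apply, LinearMap.sub_apply,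
    hz, map_zero, add_zero] at this
  exact this

/-! ### Quotients of an abelian group -/

/-- A surjection from the abelian group `A` onto an abelian group. -/
structure Surjection (A : Type u) [AddCommGroup A] where
  target : Type u
  [addCommGroup : AddCommGroup target]
  hom : A →+ target
  surjective : Function.Surjective hom

attribute [instance] Surjection.addCommGroup

/-- Two surjections `σ : A ↠ K` and `τ : A ↠ L` are equivalent if `h σ = τ` for an isomorphism
`h : K ≃ L`. -/
instance surjectionSetoid (A : Type u) [AddCommGroup A] : Setoid (Surjection A) where
  r σ τ := ∃ h : σ.target ≃+ τ.target, ∀ a, h (σ.hom a) = τ.hom a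
  iseqv :=
    { refl := fun σ => ⟨AddEquiv.refl _, fun _ => rfl⟩
      symm := fun {σ τ} ⟨h, hh⟩ => ⟨h.symm, fun a => by rw [← hh a, AddEquiv.symm_apply_apply]⟩
      trans := fun {σ τ ρ} ⟨h, hh⟩ ⟨k, hk⟩ =>
        ⟨h.trans k, fun a => by rw [AddEquiv.trans_apply, hh a, hk a]⟩ }

/-- `Quot(A)`: the equivalence classes of surjections out of the abelian group `A`. -/
def Quo (A : Type u) [AddCommGroup A] : Type (u + 1) := Quotient (surjectionSetoid A)

/-- The class `[σ]` of a surjection `σ : A ↠ K`. -/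
def Quo.mk {A K : Type u} [AddCommGroup A] [AddCommGroup K] (σ : A →+ K)
    (hσ : Function.Surjective σ) : Quo A :=
  Quotient.mk (surjectionSetoid A) ⟨K, σ, hσ⟩

/-! ### The right action of `Out(G)` on `Quot(H₂(G))` -/

theorem Schur.map_surjective {G : Type u} [Group G] (h : MulAut G) :
    Function.Surjective (Schur.map h.toMonoidHom) := by
  intro x
  refine ⟨Schur.map h.symm.toMonoidHom x, ?_⟩
  rw [← AddMonoidHom.comp_apply, ← Schur.map_comp]
  have : h.toMonoidHom.comp h.symm.toMonoidHom = MonoidHom.id G := by ext; simp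
  rw [this, Schur.map_id]; rfl

/-- `[σ] ↦ [σ ∘ H₂(h)]` for an automorphism `h` of `G`. -/
def precomp {G : Type u} [Group G] (h : MulAut G) : Quo (Schur G) → Quo (Schur G) :=
  Quotient.map
    (fun σ => ⟨σ.target, σ.hom.comp (Schur.map h.toMonoidHom),
      σ.surjective.comp (Schur.map_surjective h)⟩)
    (fun _ _ ⟨k, hk⟩ => ⟨k, fun _ => hk _⟩)

theorem precomp_one {G : Type u} [Group G] (q : Quo (Schur G)) : precomp 1 q = q := by
  induction q using Quotient.inductionOn with
  | h σ =>
    have h : Schur.map (1 : MulAut G).toMonoidHom = AddMonoidHom.id _ := Schur.map_id G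
    exact Quotient.sound ⟨AddEquiv.refl _, fun a => congrArg σ.hom (DFunLike.congr_fun h a)⟩

theorem precomp_mul {G : Type u} [Group G] (h k : MulAut G) (q : Quo (Schur G)) :
    precomp (h * k) q = precomp k (precomp h q) := by
  induction q using Quotient.inductionOn with
  | h σ =>
    have e : Schur.map (h * k).toMonoidHom =
        (Schur.map h.toMonoidHom).comp (Schur.map k.toMonoidHom) :=
      Schur.map_comp h.toMonoidHom k.toMonoidHom
    exact Quotient.sound ⟨AddEquiv.refl _, fun a => congrArg σ.hom (DFunLike.congr_fun e a)⟩

theorem precomp_conj {G : Type u} [Group G] (t : G) (q : Quo (Schur G)) :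
    precomp (MulAut.conj t) q = q := by
  induction q using Quotient.inductionOn with
  | h σ =>
    exact Quotient.sound
      ⟨AddEquiv.refl _, fun a => congrArg σ.hom (DFunLike.congr_fun (Schur.map_conj t) a)⟩

instance innNormal (G : Type u) [Group G] : (MulAut.conj : G →* MulAut G).range.Normal where
  conj_mem := by
    rintro _ ⟨g, rfl⟩ a
    exact ⟨a g, by ext x; simp [MulAut.conj_apply]⟩

/-- The outer automorphism group `Out(G) = Aut(G) / Inn(G)`. -/
abbrev Out (G : Type u) [Group G] : Type u := MulAut G ⧸ (MulAut.conj : G →* MulAut G).range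

/-- The right action of `Aut(G)`, as a homomorphism to the opposite of the permutation group. -/
def autAction (G : Type u) [Group G] : MulAut G →* (Equiv.Perm (Quo (Schur G)))ᵐᵒᵖ where
  toFun h := MulOpposite.op
    { toFun := precomp h
      invFun := precomp h⁻¹
      left_inv := fun q => by rw [← precomp_mul, mul_inv_cancel, precomp_one]
      right_inv := fun q => by rw [← precomp_mul, inv_mul_cancel, precomp_one] }
  map_one' := by
    apply MulOpposite.unop_injective
    ext q
    exact precomp_one q
  map_mul' h k := by
    apply MulOpposite.unop_injective
    ext q
    exact precomp_mul h k q

/-- The induced right action of `Out(G)`. -/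
def outAction (G : Type u) [Group G] : Out G →* (Equiv.Perm (Quo (Schur G)))ᵐᵒᵖ :=
  QuotientGroup.lift _ (autAction G) (by
    rintro _ ⟨t, rfl⟩
    apply MulOpposite.unop_injective
    ext q
    exact precomp_conj t q)

/-- The right action `([σ], [h]) ↦ [σ ∘ H₂(h)]` of `Out(G)` on `Quot(H₂(G))`. -/
instance outMulAction (G : Type u) [Group G] : MulAction (Out G)ᵐᵒᵖ (Quo (Schur G)) where
  smul o q := (outAction G o.unop).unop q
  one_smul q := by
    change (outAction G 1).unop q = q
    rw [map_one]; rfl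
  mul_smul o o' q := by
    change (outAction G (o'.unop * o.unop)).unop q = _
    rw [map_mul]; rfl

theorem outMulAction_mk {G : Type u} [Group G] (h : MulAut G) {K : Type u} [AddCommGroup K]
    (σ : Schur G →+ K) (hσ : Function.Surjective σ) :
    MulOpposite.op (QuotientGroup.mk h : Out G) • Quo.mk σ hσ =
      Quo.mk (σ.comp (Schur.map h.toMonoidHom)) (hσ.comp (Schur.map_surjective h)) := rfl

/-- `InvQuot(H₂(G))`: the elements of `Quot(H₂(G))` fixed by `Out(G)`. -/
def InvQuot (G : Type u) [Group G] : Set (Quo (Schur G)) :=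
  MulAction.fixedPoints (Out G)ᵐᵒᵖ (Quo (Schur G))

/-! ### Central extensions and their differentials -/

/-- A central extension of `G`: a surjective homomorphism onto `G` with central kernel. -/
structure CentralExtension (G : Type u) [Group G] where
  carrier : Type u
  [group : Group carrier]
  hom : carrier →* G
  surjective : Function.Surjective hom
  central : hom.ker ≤ Subgroup.center carrier

attribute [instance] CentralExtension.group

namespace CentralExtension

variable {G : Type u} [Group G] (E : CentralExtension G)

/-- The kernel of a central extension, written additively. -/
def Kernel : Type u := Additive E.hom.ker

instance : AddCommGroup E.Kernel :=
  letI : CommGroup E.hom.ker :=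
    { (inferInstance : Group E.hom.ker) with
      mul_comm := fun a b =>
        Subtype.ext ((Subgroup.mem_center_iff.1 (E.central a.2) b.1).symm) }
  inferInstanceAs (AddCommGroup (Additive E.hom.ker))

/-- A set-theoretic section. -/
def sec (g : G) : E.carrier := Function.surjInv E.surjective g

theorem hom_sec (g : G) : E.hom (E.sec g) = g := Function.surjInv_eq E.surjective g

/-- The `2`-cocycle `s(g) s(h) s(gh)⁻¹` that represents the class of the extension in
`H²(G, K)`. -/
def cocycle (g h : G) : E.Kernel :=
  Additive.ofMul ⟨E.sec g * E.sec h * (E.sec (g * h))⁻¹, by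
    simp [MonoidHom.mem_ker, hom_sec]⟩

theorem cocycle_eq (g h j : G) :
    E.cocycle h j - E.cocycle (g * h) j + E.cocycle g (h * j) - E.cocycle g h = 0 := by
  have key : E.cocycle h j + E.cocycle g (h * j) = E.cocycle g h + E.cocycle (g * h) j := by
    apply Additive.toMul.injective
    apply Subtype.ext
    have hc : E.sec h * E.sec j * (E.sec (h * j))⁻¹ ∈ Subgroup.center E.carrier :=
      E.central (E.cocycle h j).toMul.2
    have hc'' := (Subgroup.mem_center_iff.1 hc (E.sec g))
    change (E.sec h * E.sec j * (E.sec (h * j))⁻¹) *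
        (E.sec g * E.sec (h * j) * (E.sec (g * (h * j)))⁻¹) =
      (E.sec g * E.sec h * (E.sec (g * h))⁻¹) *
        (E.sec (g * h) * E.sec j * (E.sec (g * h * j))⁻¹)
    calc _ = (E.sec h * E.sec j * (E.sec (h * j))⁻¹ * E.sec g) *
          (E.sec (h * j) * (E.sec (g * (h * j)))⁻¹) := by group
      _ = (E.sec g * (E.sec h * E.sec j * (E.sec (h * j))⁻¹)) *
          (E.sec (h * j) * (E.sec (g * (h * j)))⁻¹) := by rw [hc'']
      _ = _ := by rw [mul_assoc g h j]; group
  rw [sub_add_eq_add_sub, key]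
  abel

/-- Evaluation of the cocycle on `2`-chains: `∑ nᵢ (gᵢ, hᵢ) ↦ ∑ nᵢ s(gᵢ) s(hᵢ) s(gᵢ hᵢ)⁻¹`. -/
def evalChains : (G × G →₀ ULift.{u} ℤ) →+ E.Kernel :=
  Finsupp.liftAddHom fun p =>
    (zmultiplesHom E.Kernel (E.cocycle p.1 p.2)).comp
      (AddEquiv.ulift : ULift.{u} ℤ ≃+ ℤ).toAddMonoidHom

theorem evalChains_single (p : G × G) (n : ULift.{u} ℤ) :
    E.evalChains (Finsupp.single p n) = n.down • E.cocycle p.1 p.2 := by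
  simp [evalChains]
  rfl

theorem evalChains_boundary (z : G × G × G →₀ ULift.{u} ℤ) :
    E.evalChains ((d₃₂ (trivZ G)).hom z) = 0 := by
  induction z using Finsupp.induction_linear with
  | zero => rw [map_zero, map_zero]
  | add z w hz hw => rw [map_add, map_add, hz, hw, add_zero]
  | single p n =>
    obtain ⟨g, h, j⟩ := p
    have d3 : (d₃₂ (trivZ G)).hom (Finsupp.single (g, h, j) n) =
        Finsupp.single (h, j) n - Finsupp.single (g * h, j) n +
        Finsupp.single (g, h * j) n - Finsupp.single (g, h) n :=
      d₃₂_single (A := trivZ G) (g, h, j) n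
    rw [d3, map_sub, map_add, map_sub, evalChains_single, evalChains_single, evalChains_single,
      evalChains_single, ← smul_sub, ← smul_add, ← smul_sub, E.cocycle_eq, smul_zero]

/-- The restriction of the evaluation to `2`-cycles. -/
def evalCycles : cycles₂ (trivZ G) →+ E.Kernel :=
  E.evalChains.comp (cycles₂ (trivZ G)).subtype.toAddMonoidHom

theorem ker_le_evalCycles : (cyclesToSchur G).ker ≤ E.evalCycles.ker := by
  intro z hz
  obtain ⟨w, hw⟩ := (cyclesToSchur_eq_zero_iff z).1 hz
  change E.evalChains z.1 = 0
  rw [← hw]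
  exact E.evalChains_boundary w

/-- The differential `μ(E) : H₂(G) → K` of a central extension of `G` by `K`: the image of its class
under `H²(G, K) → Hom(H₂(G), K)`, that is, evaluation of a representing cocycle on `2`-cycles. -/
def differential : Schur G →+ E.Kernel :=
  (cyclesToSchur G).liftOfSurjective (cyclesToSchur_surjective G)
    ⟨E.evalCycles, E.ker_le_evalCycles⟩

theorem differential_cyclesToSchur (z : cycles₂ (trivZ G)) :
    E.differential (cyclesToSchur G z) = E.evalChains z.1 :=
  AddMonoidHom.liftOfRightInverse_comp_apply _ _ _ ⟨E.evalCycles, E.ker_le_evalCycles⟩ z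

end CentralExtension

/-! ### Cellular covers -/

/-- A cellular cover of `G`: a homomorphism `c : X → G` such that
`Hom(X, c) : Hom(X, X) → Hom(X, G)` is a bijection. -/
structure CellularCover (G : Type u) [Group G] where
  carrier : Type u
  [group : Group carrier]
  hom : carrier →* G
  bijective : Function.Bijective fun φ : carrier →* carrier => hom.comp φ

attribute [instance] CellularCover.group

/-- Cellular covers `c : X → G` and `d : Y → G` are equivalent if `d h = c` for an isomorphism
`h : X ≃ Y`. -/
instance coverSetoid (G : Type u) [Group G] : Setoid (CellularCover G) where
  r c d := ∃ h : c.carrier ≃* d.carrier, ∀ x, d.hom (h x) = c.hom x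
  iseqv :=
    { refl := fun c => ⟨MulEquiv.refl _, fun _ => rfl⟩
      symm := fun {c d} ⟨h, hh⟩ => ⟨h.symm, fun x => by rw [← hh, MulEquiv.apply_symm_apply]⟩
      trans := fun {c d e} ⟨h, hh⟩ ⟨k, hk⟩ =>
        ⟨h.trans k, fun x => by rw [MulEquiv.trans_apply, hk, hh]⟩ }

/-- `Cov(G)`: the equivalence classes of cellular covers of `G`. -/
def Cov (G : Type u) [Group G] : Type (u + 1) := Quotient (coverSetoid G)

/-- The class of a cellular cover. -/
def Cov.mk {G : Type u} [Group G] (c : CellularCover G) : Cov G := Quotient.mk (coverSetoid G) c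

/-- `SurCov(G)`: the classes that are represented by surjective cellular covers. -/
def SurCov (G : Type u) [Group G] : Set (Cov G) :=
  {q | ∃ c : CellularCover G, Function.Surjective c.hom ∧ Cov.mk c = q}

namespace CellularCover

variable {G : Type u} [Group G] (c : CellularCover G)

theorem ker_le_center : c.hom.ker ≤ Subgroup.center c.carrier := by
  intro x hx
  have h : (MulAut.conj x).toMonoidHom = MonoidHom.id c.carrier := by
    apply c.bijective.1
    ext y
    simp [MonoidHom.mem_ker.1 hx]
  rw [Subgroup.mem_center_iff]
  intro y
  have := DFunLike.congr_fun h y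
  simp only [MulEquiv.toMonoidHom_eq_coe, MonoidHom.coe_coe,
    MulAut.conj_apply, MonoidHom.id_apply] at this
  exact (mul_inv_eq_iff_eq_mul.1 this).symm

/-- A surjective cellular cover is a central extension. -/
def toCentralExtension (hc : Function.Surjective c.hom) : CentralExtension G where
  carrier := c.carrier
  hom := c.hom
  surjective := hc
  central := c.ker_le_center

end CellularCover

end CellCover

end

/-! A finite simple group is perfect or cyclic of prime order. In the perfect case H₁(G) = 0, so the
universal coefficient map H²(G, K) → Hom(H₂(G), K) is bijective. Concretely, d : C₂ → C₁ is onto a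
free module and hence splits; so a function that vanishes on cycles is a coboundary
(`exists_coboundary_of_chainEval_eq_zero`), and every homomorphism out of H₂(G) comes from a cocycle
(`CentralExtension.exists_differential_eq`). It follows that maps of kernels compatible with the
differentials extend to maps of extensions (`exists_lift`, `exists_extend`).

Let c : X → G be a surjective cellular cover with kernel K. X has no nontrivial endomorphism with
values in K, and the transfer then bounds its exponent (`exists_exponent`). If μ(c) were not onto,
its cokernel would have a nonzero map to some ℤ/p, which extends to X and is nontrivial on K; then K
has an element of order p, and X → ℤ/p → K is a forbidden endomorphism. Automorphisms of G lift
uniquely to X, which makes [μ(c)] invariant. Covers with equivalent differentials are isomorphic by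
`exists_lift`.

Conversely, let E have differential an invariant quotient σ. E is perfect because σ is onto, so
lifts of maps into G are unique. By simplicity and an index count a nontrivial map E → G is the
projection followed by an automorphism of G; this lifts to E because σ is invariant. Hence E is
cellular.

For G of prime order a surjective cover is an isomorphism and H₂(G) = 0, so both sides have one
element. -/

noncomputable section

namespace CellCover

open groupHomology

/-! ### Evaluation of functions on chains -/

/-- Linear extension of a function of two variables to the inhomogeneous `2`-chains. -/
def chainEval {G : Type u} {B : Type*} [AddCommGroup B] (f : G → G → B) :
    (G × G →₀ ULift.{u} ℤ) →+ B :=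
  Finsupp.liftAddHom fun p =>
    (zmultiplesHom B (f p.1 p.2)).comp (AddEquiv.ulift : ULift.{u} ℤ ≃+ ℤ).toAddMonoidHom

/-- Linear extension of a function to the inhomogeneous `1`-chains. -/
def chainEval₁ {G : Type u} {B : Type*} [AddCommGroup B] (q : G → B) :
    (G →₀ ULift.{u} ℤ) →+ B :=
  Finsupp.liftAddHom fun g =>
    (zmultiplesHom B (q g)).comp (AddEquiv.ulift : ULift.{u} ℤ ≃+ ℤ).toAddMonoidHom

section chainEval

variable {G : Type u} {B C : Type*} [AddCommGroup B] [AddCommGroup C]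

@[simp]
theorem chainEval_single (f : G → G → B) (p : G × G) (n : ULift.{u} ℤ) :
    chainEval f (Finsupp.single p n) = n.down • f p.1 p.2 := by
  simp [chainEval]
  rfl

@[simp]
theorem chainEval₁_single (q : G → B) (g : G) (n : ULift.{u} ℤ) :
    chainEval₁ q (Finsupp.single g n) = n.down • q g := by
  simp [chainEval₁]
  rfl

theorem map_chainEval (θ : B →+ C) (f : G → G → B) (z : G × G →₀ ULift.{u} ℤ) :
    θ (chainEval f z) = chainEval (fun g h => θ (f g h)) z := by
  induction z using Finsupp.induction_linear with
  | zero => simp only [map_zero]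
  | add z w hz hw => simp only [map_add, hz, hw]
  | single p n => simp

theorem chainEval_apply_single_one (F : (G × G →₀ ULift.{u} ℤ) →+ B)
    (z : G × G →₀ ULift.{u} ℤ) :
    chainEval (fun g h => F (Finsupp.single (g, h) 1)) z = F z := by
  induction z using Finsupp.induction_linear with
  | zero => simp only [map_zero]
  | add z w hz hw => simp only [map_add, hz, hw]
  | single p n =>
    rw [chainEval_single, ← map_zsmul, Finsupp.smul_single]
    congr 2
    ext
    simp

variable [Group G]

theorem d₂₁_trivZ_single (p : G × G) (n : ULift.{u} ℤ) :
    (d₂₁ (trivZ G)).hom (Finsupp.single p n) =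
      Finsupp.single p.2 n - Finsupp.single (p.1 * p.2) n + Finsupp.single p.1 n :=
  d₂₁_single (A := trivZ G) p n

theorem d₃₂_trivZ_single (p : G × G × G) (n : ULift.{u} ℤ) :
    (d₃₂ (trivZ G)).hom (Finsupp.single p n) =
      Finsupp.single (p.2.1, p.2.2) n - Finsupp.single (p.1 * p.2.1, p.2.2) n +
      Finsupp.single (p.1, p.2.1 * p.2.2) n - Finsupp.single (p.1, p.2.1) n :=
  d₃₂_single (A := trivZ G) p n

theorem chainsMap₂_trivZ_single {H : Type u} [Group H] (α : G →* H) (p : G × G)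
    (n : ULift.{u} ℤ) :
    (chainsMap₂ α (trivZHom α)).hom (Finsupp.single p n) =
      Finsupp.single (α p.1, α p.2) n := by
  simp [chainsMap₂, trivZHom]
  rfl

theorem chainEval_chainsMap₂ {H : Type u} [Group H] (α : G →* H) (f : H → H → B)
    (z : G × G →₀ ULift.{u} ℤ) :
    chainEval f ((chainsMap₂ α (trivZHom α)).hom z) =
      chainEval (fun g h => f (α g) (α h)) z := by
  induction z using Finsupp.induction_linear with
  | zero => simp only [map_zero]
  | add z w hz hw => simp only [map_add, hz, hw]
  | single p n =>
    rw [chainsMap₂_trivZ_single]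
    simp only [chainEval_single]

/-- Evaluating a coboundary is evaluating on the boundary of the chain. -/
theorem chainEval_coboundary (q : G → B) (z : G × G →₀ ULift.{u} ℤ) :
    chainEval (fun g h => q g + q h - q (g * h)) z = chainEval₁ q ((d₂₁ (trivZ G)).hom z) := by
  induction z using Finsupp.induction_linear with
  | zero => simp only [map_zero]
  | add z w hz hw => simp only [map_add, hz, hw]
  | single p n =>
    rw [d₂₁_trivZ_single]
    simp only [chainEval_single, map_add, map_sub, chainEval₁_single, smul_add, smul_sub]
    abel

/-- Functions that differ by a coboundary agree on cycles. -/
theorem chainEval_congr_of_coboundary {f f' : G → G → B} (q : G → B)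
    (hq : ∀ g h, f g h = f' g h + (q g + q h - q (g * h))) (z : cycles₂ (trivZ G)) :
    chainEval f z.1 = chainEval f' z.1 := by
  have h1 : ∀ z, chainEval f z = chainEval f' z +
      chainEval (fun g h => q g + q h - q (g * h)) z := by
    intro z
    induction z using Finsupp.induction_linear with
    | zero => simp only [map_zero, add_zero]
    | add z w hz hw => simp only [map_add, hz, hw]; abel
    | single p n => simp [hq]
  have hz : (d₂₁ (trivZ G)).hom z.1 = 0 := z.2
  rw [h1, chainEval_coboundary, hz, map_zero, add_zero]

/-- For a perfect group all `1`-chains with trivial integral coefficients are boundaries. -/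
theorem d₂₁_trivZ_surjective (hG : commutator G = ⊤) :
    Function.Surjective (d₂₁ (trivZ G)).hom := by
  set R : Submodule (ULift.{u} ℤ) (G →₀ ULift.{u} ℤ) := LinearMap.range (d₂₁ (trivZ G)).hom
    with hR
  -- Modulo boundaries [gh] = [g] + [h], so g ↦ [g] is a homomorphism to an abelian group and is
  -- trivial because G is perfect.
  let ψ : G →* Multiplicative ((G →₀ ULift.{u} ℤ) ⧸ R) := MonoidHom.mk'
    (fun g => Multiplicative.ofAdd (R.mkQ (Finsupp.single g 1))) (by
      intro g h
      rw [← ofAdd_add, ← map_add]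
      congr 1
      refine ((Submodule.Quotient.eq R).2 ⟨-Finsupp.single (g, h) 1, ?_⟩)
      rw [map_neg, d₂₁_trivZ_single]
      abel)
  have hψ : ∀ g, Finsupp.single g (1 : ULift.{u} ℤ) ∈ R := by
    intro g
    have : g ∈ ψ.ker := Abelianization.commutator_subset_ker ψ (hG ▸ Subgroup.mem_top g)
    exact (Submodule.Quotient.mk_eq_zero R).1 this
  rw [← LinearMap.range_eq_top, ← hR, eq_top_iff]
  intro x _
  induction x using Finsupp.induction_linear with
  | zero => exact R.zero_mem
  | add x y hx hy => exact R.add_mem (hx trivial) (hy trivial)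
  | single g n =>
    have := R.smul_mem n (hψ g)
    rwa [Finsupp.smul_single, smul_eq_mul, mul_one] at this

theorem exists_section_d₂₁ (hG : commutator G = ⊤) :
    ∃ r : (G →₀ ULift.{u} ℤ) →ₗ[ULift.{u} ℤ] (G × G →₀ ULift.{u} ℤ),
      ∀ x, (d₂₁ (trivZ G)).hom (r x) = x := by
  obtain ⟨r, hr⟩ := Module.projective_lifting_property (P := G →₀ ULift.{u} ℤ)
    (d₂₁ (trivZ G)).hom LinearMap.id (d₂₁_trivZ_surjective hG)
  exact ⟨r, fun x => LinearMap.congr_fun hr x⟩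

/-- For a perfect group a function that vanishes on cycles is a coboundary. -/
theorem exists_coboundary_of_chainEval_eq_zero (hG : commutator G = ⊤) (f : G → G → B)
    (hf : ∀ z : cycles₂ (trivZ G), chainEval f z.1 = 0) :
    ∃ q : G → B, ∀ g h, f g h = q g + q h - q (g * h) := by
  obtain ⟨r, hr⟩ := exists_section_d₂₁ hG
  refine ⟨fun g => chainEval f (r (Finsupp.single g 1)), fun g h => ?_⟩
  -- Subtracting r(d[g|h]) from [g|h] leaves a cycle, on which f vanishes; so f(g, h) depends only
  -- on d[g|h] = [h] - [gh] + [g].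
  have hz : Finsupp.single (g, h) 1 - r ((d₂₁ (trivZ G)).hom (Finsupp.single (g, h) 1)) ∈
      cycles₂ (trivZ G) := by
    change (d₂₁ (trivZ G)).hom _ = 0
    rw [map_sub, hr, sub_self]
  have : chainEval f
      (Finsupp.single (g, h) 1 - r ((d₂₁ (trivZ G)).hom (Finsupp.single (g, h) 1))) = 0 :=
    hf ⟨_, hz⟩
  rw [d₂₁_trivZ_single] at this
  simp only [map_sub, map_add, chainEval_single, ULift.one_down, one_smul] at this
  rw [sub_eq_zero.1 this]
  abel

theorem cyclesToSchur_map {H : Type u} [Group H] (α : G →* H) (z : cycles₂ (trivZ G)) :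
    Schur.map α (cyclesToSchur G z) = cyclesToSchur H (mapCycles₂ α (trivZHom α) z) :=
  congrArg (fun φ => φ.hom z) (H2π_comp_map α (trivZHom α))

end chainEval

/-! ### Morphisms of central extensions -/

namespace CentralExtension

variable {G H : Type u} [Group G] [Group H] (E : CentralExtension G) (F : CentralExtension H)

/-- The inclusion of the kernel. -/
def incl (k : E.Kernel) : E.carrier := (Additive.toMul k).1

/-- An element over `1` as an element of the kernel. -/
def toKernel (x : E.carrier) (hx : E.hom x = 1) : E.Kernel := Additive.ofMul ⟨x, hx⟩

@[simp] theorem incl_toKernel (x : E.carrier) (hx : E.hom x = 1) :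
    E.incl (E.toKernel x hx) = x := rfl

@[simp] theorem hom_incl (k : E.Kernel) : E.hom (E.incl k) = 1 := (Additive.toMul k).2

theorem incl_injective : Function.Injective E.incl := fun _ _ h =>
  Additive.toMul.injective (Subtype.ext h)

theorem incl_add (k l : E.Kernel) : E.incl (k + l) = E.incl k * E.incl l := rfl

@[simp] theorem incl_zero : E.incl 0 = 1 := rfl

theorem incl_mul_comm (k : E.Kernel) (x : E.carrier) : E.incl k * x = x * E.incl k :=
  (Subgroup.mem_center_iff.1 (E.central (Additive.toMul k).2) x).symm

theorem incl_cocycle_mul (g h : G) : E.incl (E.cocycle g h) * E.sec (g * h) =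
    E.sec g * E.sec h := by
  change E.sec g * E.sec h * (E.sec (g * h))⁻¹ * E.sec (g * h) = _
  group

/-- The kernel component of an element with respect to the chosen section. -/
def kerPart (x : E.carrier) : E.Kernel :=
  E.toKernel (x * (E.sec (E.hom x))⁻¹) (by simp [hom_sec])

theorem incl_kerPart_mul (x : E.carrier) : E.incl (E.kerPart x) * E.sec (E.hom x) = x := by
  simp [kerPart]

theorem kerPart_mul (x y : E.carrier) : E.kerPart (x * y) =
    E.kerPart x + E.kerPart y + E.cocycle (E.hom x) (E.hom y) := by
  apply E.incl_injective
  have h := E.incl_kerPart_mul (x * y)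
  rw [map_mul] at h
  rw [incl_add, incl_add, ← mul_left_inj (E.sec (E.hom x * E.hom y)), h, mul_assoc,
    incl_cocycle_mul]
  nth_rw 1 [← E.incl_kerPart_mul x, ← E.incl_kerPart_mul y]
  simp only [mul_assoc]
  congr 1
  simp only [← mul_assoc]
  rw [← E.incl_mul_comm]

/-- The correction `E.kerPart 1` appears because the section need not send 1 to 1. -/
theorem kerPart_incl (k : E.Kernel) : E.kerPart (E.incl k) = k + E.kerPart 1 := by
  apply E.incl_injective
  simp [kerPart, incl_add]

theorem evalChains_eq (z : G × G →₀ ULift.{u} ℤ) :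
    E.evalChains z = chainEval E.cocycle z := rfl

/-- The restriction of a morphism of extensions to the kernels. -/
def kerMap (φ : E.carrier →* F.carrier) (h : ∀ x, E.hom x = 1 → F.hom (φ x) = 1) :
    E.Kernel →+ F.Kernel where
  toFun k := F.toKernel (φ (E.incl k)) (h _ (E.hom_incl k))
  map_zero' := F.incl_injective (by simp)
  map_add' k l := F.incl_injective (by simp [incl_add])

variable {E F}

/-- Naturality of the differential. -/
theorem differential_natural (α : G →* H) (φ : E.carrier →* F.carrier)
    (hφ : ∀ x, F.hom (φ x) = α (E.hom x)) (θ : E.Kernel →+ F.Kernel)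
    (hθ : ∀ k, F.incl (θ k) = φ (E.incl k)) (a : Schur G) :
    F.differential (Schur.map α a) = θ (E.differential a) := by
  obtain ⟨z, rfl⟩ := cyclesToSchur_surjective G a
  rw [cyclesToSchur_map, differential_cyclesToSchur, differential_cyclesToSchur,
    evalChains_eq, evalChains_eq, map_chainEval]
  refine (chainEval_chainsMap₂ α F.cocycle z.1).trans ?_
  -- q measures how far φ is from carrying one section to the other; its coboundary is the
  -- difference of the two cocycles over G.
  let q : G → F.Kernel := fun g => F.toKernel (φ (E.sec g) * (F.sec (α g))⁻¹)
    (by simp [hφ, hom_sec])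
  have hq : ∀ g, φ (E.sec g) = F.incl (q g) * F.sec (α g) := fun g => by simp [q]
  refine (chainEval_congr_of_coboundary q (fun g h => ?_) z).symm
  apply F.incl_injective
  have e := congrArg φ (E.incl_cocycle_mul g h)
  have e2 : F.incl (q g) * F.sec (α g) * (F.incl (q h) * F.sec (α h)) =
      F.incl (q g) * F.incl (q h) * (F.incl (F.cocycle (α g) (α h)) * F.sec (α (g * h))) := by
    rw [map_mul α, incl_cocycle_mul]
    simp only [mul_assoc]
    congr 1
    simp only [← mul_assoc]
    rw [F.incl_mul_comm]
  rw [map_mul, map_mul, ← hθ, hq, hq, hq, e2, ← mul_assoc, ← mul_assoc, mul_left_inj] at e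
  rw [← incl_add, ← incl_add, ← incl_add] at e
  rw [eq_sub_of_add_eq (F.incl_injective e)]
  congr 1
  abel

/-- Over a perfect group, a morphism of kernels that is compatible with the differentials extends
to a morphism of extensions. -/
theorem exists_lift (hG : commutator G = ⊤) (α : G →* H) (θ : E.Kernel →+ F.Kernel)
    (hθ : ∀ a, F.differential (Schur.map α a) = θ (E.differential a)) :
    ∃ φ : E.carrier →* F.carrier, (∀ x, F.hom (φ x) = α (E.hom x)) ∧
      ∀ k, φ (E.incl k) = F.incl (θ k) := by
  obtain ⟨q, hq⟩ := exists_coboundary_of_chainEval_eq_zero hG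
    (fun g h => θ (E.cocycle g h) - F.cocycle (α g) (α h)) (fun z => by
      have h := hθ (cyclesToSchur G z)
      rw [cyclesToSchur_map, differential_cyclesToSchur, differential_cyclesToSchur,
        evalChains_eq, evalChains_eq, map_chainEval] at h
      have h2 := (chainEval_chainsMap₂ α F.cocycle z.1).symm.trans h
      have h1 : ∀ z, chainEval (fun g h => θ (E.cocycle g h) - F.cocycle (α g) (α h)) z =
          chainEval (fun g h => θ (E.cocycle g h)) z -
          chainEval (fun g h => F.cocycle (α g) (α h)) z := by
        intro z
        induction z using Finsupp.induction_linear with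
        | zero => simp only [map_zero, sub_zero]
        | add z w hz hw => simp only [map_add, hz, hw]; abel
        | single p n => simp [smul_sub]
      rw [h1, h2, sub_self])
  -- On k · s(g) the map is θ(k) + q(g) times s(α g); the coboundary of q compensates for the
  -- difference of the cocycles.
  let φ : E.carrier →* F.carrier := MonoidHom.mk'
    (fun x => F.incl (θ (E.kerPart x) + q (E.hom x)) * F.sec (α (E.hom x))) (fun x y => by
      have e : θ (E.kerPart (x * y)) + q (E.hom (x * y)) =
          (θ (E.kerPart x) + q (E.hom x)) + (θ (E.kerPart y) + q (E.hom y)) +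
            F.cocycle (α (E.hom x)) (α (E.hom y)) := by
        have := hq (E.hom x) (E.hom y)
        rw [kerPart_mul, map_add, map_add, sub_eq_iff_eq_add.1 this, map_mul]
        abel
      rw [e, incl_add, map_mul E.hom, map_mul α, mul_assoc, incl_cocycle_mul, incl_add]
      simp only [mul_assoc]
      congr 1
      simp only [← mul_assoc]
      rw [F.incl_mul_comm])
  have hφ : ∀ x, φ x = F.incl (θ (E.kerPart x) + q (E.hom x)) * F.sec (α (E.hom x)) :=
    fun x => rfl
  refine ⟨φ, fun x => by simp [hφ, hom_sec], fun k => ?_⟩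
  -- Since φ(1) = 1, the contributions of `E.kerPart 1`, q(1) and s(1) cancel.
  have h1 := hφ 1
  rw [map_one] at h1
  rw [hφ, kerPart_incl, map_add, add_assoc, incl_add, mul_assoc, hom_incl, ← map_one E.hom,
    ← h1, mul_one]

/-- Over a perfect group, a homomorphism on the kernel that kills the image of the differential
extends to the whole extension. -/
theorem exists_extend (hG : commutator G = ⊤) {B : Type*} [AddCommGroup B] (u : E.Kernel →+ B)
    (hu : ∀ a, u (E.differential a) = 0) :
    ∃ ψ : E.carrier →* Multiplicative B, ∀ k, ψ (E.incl k) = Multiplicative.ofAdd (u k) := by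
  obtain ⟨q, hq⟩ := exists_coboundary_of_chainEval_eq_zero hG
    (fun g h => u (E.cocycle g h)) (fun z => by
      have h := hu (cyclesToSchur G z)
      rwa [differential_cyclesToSchur, evalChains_eq, map_chainEval] at h)
  let ψ : E.carrier →* Multiplicative B := MonoidHom.mk'
    (fun x => Multiplicative.ofAdd (u (E.kerPart x) + q (E.hom x))) (fun x y => by
      rw [← ofAdd_add, kerPart_mul, map_add u, map_add u, hq, map_mul]
      congr 1
      abel)
  have hψ : ∀ x, ψ x = Multiplicative.ofAdd (u (E.kerPart x) + q (E.hom x)) := fun x => rfl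
  refine ⟨ψ, fun k => ?_⟩
  have h1 := hψ 1
  rw [map_one] at h1
  rw [hψ, kerPart_incl, map_add u, add_assoc, ofAdd_add, hom_incl, ← map_one E.hom, ← h1, mul_one]

/-- The restriction to the kernel of a homomorphism to an abelian group kills the image of the
differential. -/
theorem map_incl_differential {B : Type*} [AddCommGroup B] (ψ : E.carrier →* Multiplicative B)
    (a : Schur G) : ψ (E.incl (E.differential a)) = 1 := by
  obtain ⟨z, rfl⟩ := cyclesToSchur_surjective G a
  let u : E.Kernel →+ B :=
    { toFun := fun k => Multiplicative.toAdd (ψ (E.incl k))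
      map_zero' := by simp
      map_add' := fun k l => by simp [incl_add] }
  change u _ = 0
  rw [differential_cyclesToSchur, evalChains_eq, map_chainEval]
  -- Applying ψ to s(g) s(h) = cocycle(g, h) · s(gh) shows that the image of the cocycle is the
  -- coboundary of ψ ∘ s.
  rw [chainEval_congr_of_coboundary (f' := fun _ _ => 0)
    (fun g => Multiplicative.toAdd (ψ (E.sec g)))]
  · have := chainEval_apply_single_one (0 : (G × G →₀ ULift.{u} ℤ) →+ B) z.1
    exact this
  · intro g h
    have e := congrArg (fun x => Multiplicative.toAdd (ψ x)) (E.incl_cocycle_mul g h)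
    simp only [map_mul, toAdd_mul] at e
    rw [zero_add, ← e]
    exact (add_sub_cancel_right _ _).symm

end CentralExtension

/-! ### The extension defined by a cocycle -/

/-- The set underlying the extension of `G` by `K` defined by the `2`-cocycle `f`. -/
@[ext]
structure CocycleExtension {G K : Type*} [Group G] [AddCommGroup K] (f : G → G → K)
    (hf : ∀ g h j, f h j - f (g * h) j + f g (h * j) - f g h = 0) where
  fst : K
  snd : G

namespace CocycleExtension

variable {G K : Type*} [Group G] [AddCommGroup K] {f : G → G → K}
  (hf : ∀ g h j, f h j - f (g * h) j + f g (h * j) - f g h = 0)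

theorem cocycle_one_left (hf : ∀ g h j, f h j - f (g * h) j + f g (h * j) - f g h = 0) (g : G) :
    f 1 g = f 1 1 := by
  have := hf 1 1 g
  simpa [sub_eq_zero] using this

theorem cocycle_one_right (hf : ∀ g h j, f h j - f (g * h) j + f g (h * j) - f g h = 0) (g : G) :
    f g 1 = f 1 1 := by
  have := hf g 1 1
  simpa [sub_eq_zero, eq_comm] using this

instance : Mul (CocycleExtension f hf) :=
  ⟨fun x y => ⟨x.fst + y.fst + f x.snd y.snd, x.snd * y.snd⟩⟩

/-- The cocycle is not assumed normalized, so (0, 1) need not be neutral and the first coordinate is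
shifted by f(1, 1). -/
instance : One (CocycleExtension f hf) := ⟨⟨-f 1 1, 1⟩⟩

instance : Inv (CocycleExtension f hf) :=
  ⟨fun x => ⟨-x.fst - f x.snd⁻¹ x.snd - f 1 1, x.snd⁻¹⟩⟩

@[simp] theorem fst_mul (x y : CocycleExtension f hf) :
    (x * y).fst = x.fst + y.fst + f x.snd y.snd := rfl

@[simp] theorem snd_mul (x y : CocycleExtension f hf) : (x * y).snd = x.snd * y.snd := rfl

@[simp] theorem fst_one : (1 : CocycleExtension f hf).fst = -f 1 1 := rfl

@[simp] theorem snd_one : (1 : CocycleExtension f hf).snd = 1 := rfl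

@[simp] theorem fst_inv (x : CocycleExtension f hf) :
    x⁻¹.fst = -x.fst - f x.snd⁻¹ x.snd - f 1 1 := rfl

@[simp] theorem snd_inv (x : CocycleExtension f hf) : x⁻¹.snd = x.snd⁻¹ := rfl

instance : Group (CocycleExtension f hf) :=
  Group.ofLeftAxioms
    (fun x y z => by
      ext
      · have := hf x.snd y.snd z.snd
        simp only [fst_mul, snd_mul]
        rw [← sub_eq_zero, ← neg_eq_zero, ← this]
        abel
      · simp [mul_assoc])
    (fun x => by ext <;> simp [cocycle_one_left hf x.snd])
    (fun x => by
      ext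
      · simp only [fst_mul, fst_inv, snd_inv, fst_one]
        abel
      · simp)

/-- The projection to `G`. -/
def proj : CocycleExtension f hf →* G where
  toFun := snd
  map_one' := rfl
  map_mul' _ _ := rfl

@[simp] theorem proj_apply (x : CocycleExtension f hf) : proj hf x = x.snd := rfl

end CocycleExtension

/-- The central extension defined by a cocycle. -/
def CentralExtension.ofCocycle {G K : Type u} [Group G] [AddCommGroup K] {f : G → G → K}
    (hf : ∀ g h j, f h j - f (g * h) j + f g (h * j) - f g h = 0) : CentralExtension G where
  carrier := CocycleExtension f hf
  hom := CocycleExtension.proj hf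
  surjective g := ⟨⟨0, g⟩, rfl⟩
  central x hx := by
    rw [MonoidHom.mem_ker, CocycleExtension.proj_apply] at hx
    rw [Subgroup.mem_center_iff]
    intro y
    ext
    · simp [hx, CocycleExtension.cocycle_one_left hf y.snd,
        CocycleExtension.cocycle_one_right hf y.snd, add_comm]
    · simp [hx]

/-- The coefficient group is the kernel of the extension defined by a cocycle. -/
def CentralExtension.kernelEquivOfCocycle {G K : Type u} [Group G] [AddCommGroup K]
    {f : G → G → K} (hf : ∀ g h j, f h j - f (g * h) j + f g (h * j) - f g h = 0) :
    K ≃+ (CentralExtension.ofCocycle hf).Kernel where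
  toFun k := (CentralExtension.ofCocycle hf).toKernel
    (⟨k - f 1 1, 1⟩ : CocycleExtension f hf) rfl
  invFun x := (show CocycleExtension f hf from
    (CentralExtension.ofCocycle hf).incl x).fst + f 1 1
  left_inv k := sub_add_cancel k _
  right_inv x := by
    apply (CentralExtension.ofCocycle hf).incl_injective
    refine CocycleExtension.ext (hf := hf) (add_sub_cancel_right _ _) ?_
    exact ((CentralExtension.ofCocycle hf).hom_incl x).symm
  map_add' k l := by
    apply (CentralExtension.ofCocycle hf).incl_injective
    refine CocycleExtension.ext (hf := hf) ?_ (mul_one 1).symm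
    change k + l - f 1 1 = (k - f 1 1) + (l - f 1 1) + f 1 1
    abel

/-- The cocycle of the extension defined by `f` differs from `f` by a coboundary. -/
theorem CentralExtension.exists_cocycle_ofCocycle {G K : Type u} [Group G] [AddCommGroup K]
    {f : G → G → K} (hf : ∀ g h j, f h j - f (g * h) j + f g (h * j) - f g h = 0) :
    ∃ q : G → K, ∀ g h, (CentralExtension.ofCocycle hf).cocycle g h =
      CentralExtension.kernelEquivOfCocycle hf (f g h + (q g + q h - q (g * h))) := by
  set E := CentralExtension.ofCocycle hf with hE
  let s : G → CocycleExtension f hf := E.sec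
  have hs : ∀ g, (s g).snd = g := E.hom_sec
  -- The section g ↦ (0, g) has cocycle exactly f; the first coordinate of the chosen section is its
  -- deviation from that one.
  refine ⟨fun g => (s g).fst, fun g h => ?_⟩
  apply E.incl_injective
  rw [← mul_left_inj (E.sec (g * h)), E.incl_cocycle_mul]
  refine CocycleExtension.ext (hf := hf) ?_ ?_
  · change (s g * s h).fst =
      (⟨f g h + ((s g).fst + (s h).fst - (s (g * h)).fst) - f 1 1, 1⟩ * s (g * h) :
        CocycleExtension f hf).fst
    simp only [CocycleExtension.fst_mul, hs, CocycleExtension.cocycle_one_left hf (g * h)]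
    abel
  · change (s g).snd * (s h).snd = 1 * (s (g * h)).snd
    simp [hs]

/-- Over a perfect group, every homomorphism out of `H₂(G)` is the differential of a central
extension. -/
theorem CentralExtension.exists_differential_eq {G K : Type u} [Group G] [AddCommGroup K]
    (hG : commutator G = ⊤) (σ : Schur G →+ K) :
    ∃ (E : CentralExtension G) (e : K ≃+ E.Kernel), ∀ a, E.differential a = e (σ a) := by
  obtain ⟨r, hr⟩ := exists_section_d₂₁ hG
  -- P = 1 - r d projects the chains onto the cycles, so σ extends to a homomorphism F on all
  -- chains. F vanishes on boundaries, which is the cocycle identity for its values on basis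
  -- elements.
  let P : (G × G →₀ ULift.{u} ℤ) →ₗ[ULift.{u} ℤ] cycles₂ (trivZ G) :=
    LinearMap.codRestrict _ (LinearMap.id - r ∘ₗ (d₂₁ (trivZ G)).hom) (fun z => by
      change (d₂₁ (trivZ G)).hom (z - r ((d₂₁ (trivZ G)).hom z)) = 0
      rw [map_sub, hr, sub_self])
  have hP : ∀ z : cycles₂ (trivZ G), P z.1 = z := fun z => by
    apply Subtype.ext
    change z.1 - r ((d₂₁ (trivZ G)).hom z.1) = z.1
    have hz : (d₂₁ (trivZ G)).hom z.1 = 0 := z.2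
    rw [hz, map_zero, sub_zero]
  let F : (G × G →₀ ULift.{u} ℤ) →+ K := (σ.comp (cyclesToSchur G)).comp P.toAddMonoidHom
  have hF : ∀ z : cycles₂ (trivZ G), F z.1 = σ (cyclesToSchur G z) := fun z =>
    congrArg (fun w => σ (cyclesToSchur G w)) (hP z)
  have hf : ∀ g h j, F (Finsupp.single (h, j) 1) - F (Finsupp.single (g * h, j) 1) +
      F (Finsupp.single (g, h * j) 1) - F (Finsupp.single (g, h) 1) = 0 := by
    intro g h j
    have hb : (d₃₂ (trivZ G)).hom (Finsupp.single (g, h, j) 1) ∈ boundaries₂ (trivZ G) :=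
      ⟨_, rfl⟩
    have := hF ⟨_, mem_cycles₂_of_mem_boundaries₂ _ hb⟩
    rw [(cyclesToSchur_eq_zero_iff _).2 hb, map_zero] at this
    change F ((d₃₂ (trivZ G)).hom (Finsupp.single (g, h, j) 1)) = 0 at this
    rw [d₃₂_trivZ_single] at this
    simpa only [map_sub, map_add] using this
  let e := CentralExtension.kernelEquivOfCocycle (f := fun g h => F (Finsupp.single (g, h) 1)) hf
  refine ⟨CentralExtension.ofCocycle hf, e, fun a => ?_⟩
  obtain ⟨z, rfl⟩ := cyclesToSchur_surjective G a
  obtain ⟨q, hq⟩ := CentralExtension.exists_cocycle_ofCocycle hf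
  rw [differential_cyclesToSchur, evalChains_eq,
    chainEval_congr_of_coboundary (f' := fun g h => e (F (Finsupp.single (g, h) 1)))
      (fun g => e (q g)) (fun g h => by rw [hq, map_add, map_sub, map_add]), ← hF]
  exact chainEval_apply_single_one (e.toAddMonoidHom.comp F) z.1

/-! ### Torsion -/

theorem exists_linear_apply_ne_zero {F V : Type*} [Field F] [AddCommGroup V] [Module F V] {v : V}
    (hv : v ≠ 0) : ∃ u : V →+ F, u v ≠ 0 := by
  obtain ⟨φ, hφ⟩ := Module.Projective.exists_dual_ne_zero F hv
  exact ⟨φ.toAddMonoidHom, hφ⟩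

theorem exists_hom_zmod_apply_ne_zero {p : ℕ} [Fact p.Prime] {V : Type*} [AddCommGroup V]
    (h : ∀ v : V, p • v = 0) {v : V} (hv : v ≠ 0) : ∃ u : V →+ ZMod p, u v ≠ 0 := by
  let : Module (ZMod p) V := AddCommGroup.zmodModule h
  exact exists_linear_apply_ne_zero hv

/-- A nontrivial abelian group of finite exponent has a nonzero homomorphism to `ℤ/p` for some
prime `p`. -/
theorem exists_hom_zmod_ne_zero {A : Type*} [AddCommGroup A] {n : ℕ} (hn : n ≠ 0)
    (h : ∀ a : A, n • a = 0) {a : A} (ha : a ≠ 0) :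
    ∃ (p : ℕ) (_ : p.Prime) (u : A →+ ZMod p), ∃ b, u b ≠ 0 := by
  by_contra! H
  -- Without such maps each vector space A/pA over ℤ/p is zero, so A is divisible; but n kills A.
  have hdiv : ∀ p : ℕ, p.Prime → ∀ a : A, ∃ b, p • b = a := by
    intro p hp a
    by_contra! hb
    have := Fact.mk hp
    let R : AddSubgroup A := (nsmulAddMonoidHom p : A →+ A).range
    have hR : ∀ v : A ⧸ R, p • v = 0 := by
      intro x
      obtain ⟨x, rfl⟩ := QuotientAddGroup.mk_surjective x
      exact (QuotientAddGroup.eq_zero_iff _).2 ⟨x, rfl⟩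
    have hne : (QuotientAddGroup.mk a : A ⧸ R) ≠ 0 := fun h0 => by
      obtain ⟨b, hb'⟩ := (QuotientAddGroup.eq_zero_iff _).1 h0
      exact hb b hb'
    obtain ⟨u, hu⟩ := exists_hom_zmod_apply_ne_zero hR hne
    exact hu (H p hp (u.comp (QuotientAddGroup.mk' R)) a)
  have hall : ∀ m : ℕ, m ≠ 0 → ∀ a : A, ∃ b, m • b = a := by
    intro m
    induction m using induction_on_primes with
    | zero => exact fun h => absurd rfl h
    | one => exact fun _ a => ⟨a, one_smul _ a⟩
    | prime_mul p m hp ih =>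
      intro hm a
      obtain ⟨b, rfl⟩ := hdiv p hp a
      obtain ⟨c, rfl⟩ := ih (right_ne_zero_of_mul hm) b
      exact ⟨c, mul_smul p m c⟩
  obtain ⟨b, rfl⟩ := hall n hn a
  exact ha (h b)

/-- If `X` has no nontrivial endomorphism with values in the kernel of `c` and `X` has finite
exponent, then homomorphisms from `X` to `ℤ/p` vanish on the kernel. -/
theorem map_ker_eq_one_of_hom_zmod {X G : Type*} [Group X] [Group G] (c : X →* G)
    (hc : ∀ φ : X →* X, (∀ x, c (φ x) = 1) → ∀ x, φ x = 1) {n : ℕ} (hn : n ≠ 0)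
    (hX : ∀ x : X, x ^ n = 1) {p : ℕ} (hp : p.Prime) (ψ : X →* Multiplicative (ZMod p))
    {x : X} (hx : c x = 1) : ψ x = 1 := by
  have := Fact.mk hp
  by_contra hne
  have ho : 0 < orderOf x := orderOf_pos_iff.2 (isOfFinOrder_iff_pow_eq_one.2
    ⟨n, Nat.pos_of_ne_zero hn, hX x⟩)
  have hψ : orderOf (ψ x) = p := by
    refine orderOf_eq_prime ?_ hne
    rw [← ofAdd_toAdd (ψ x), ← ofAdd_nsmul]
    simp
  have hdvd : p ∣ orderOf x := hψ ▸ orderOf_map_dvd ψ x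
  have hy : orderOf (x ^ (orderOf x / p)) = p := orderOf_pow_orderOf_div ho.ne' hdvd
  set y := x ^ (orderOf x / p) with hydef
  have hcy : c y = 1 := by rw [hydef, map_pow, hx, one_pow]
  -- The kernel element y of order p embeds ℤ/p in the kernel of c. Composed with ψ this is an
  -- endomorphism that c kills, yet it is nontrivial at x.
  let l : ZMod p →+ Additive X := ZMod.lift p ⟨zmultiplesHom (Additive X) (Additive.ofMul y), by
    change (p : ℤ) • Additive.ofMul y = 0
    rw [natCast_zsmul, ← ofMul_pow, ← hy, pow_orderOf_eq_one, ofMul_one]⟩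
  have hl : ∀ m : ℤ, l (m : ZMod p) = Additive.ofMul (y ^ m) := fun m => by
    simp [l]
  let φ : X →* X := (AddMonoidHom.toMultiplicativeLeft l).comp ψ
  have hφ : ∀ z, φ z = (l (ψ z).toAdd).toMul := fun z => rfl
  have h1 : ∀ z, φ z = 1 := hc φ fun z => by
    obtain ⟨m, hm⟩ := ZMod.intCast_surjective (ψ z).toAdd
    rw [hφ, ← hm, hl, toMul_ofMul, map_zpow, hcy, one_zpow]
  have h2 := h1 x
  obtain ⟨m, hm⟩ := ZMod.intCast_surjective (ψ x).toAdd
  rw [hφ, ← hm, hl, toMul_ofMul, ← orderOf_dvd_iff_zpow_eq_one, hy,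
    ← ZMod.intCast_zmod_eq_zero_iff_dvd, hm] at h2
  exact hne h2

/-! ### The Schur multiplier of a cyclic group -/

/-- H₂ of a finite cyclic group is a quotient of the kernel of the norm; on trivial ℤ the norm is
multiplication by |G|, which is injective. -/
theorem schur_subsingleton_of_isCyclic (G : Type u) [CommGroup G] [Finite G] [IsCyclic G] :
    Subsingleton (Schur G) := by
  classical
  obtain ⟨g, hg⟩ := IsCyclic.exists_generator (α := G)
  have := Fintype.ofFinite G
  have hsurj : Function.Surjective
      (Rep.FiniteCyclicGroup.groupHomologyπEven (trivZ G) g hg 2 even_two).hom := by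
    refine (ModuleCat.epi_iff_surjective _).1 ?_
    unfold Rep.FiniteCyclicGroup.groupHomologyπEven
    exact CategoryTheory.epi_comp'
      (@CategoryTheory.IsIso.epi_of_iso _ _ _ _ _ (CategoryTheory.Iso.isIso_inv _))
      (CategoryTheory.epi_comp' inferInstance inferInstance)
  have hker : ∀ x : LinearMap.ker (trivZ G).ρ.norm, x = 0 := by
    rintro ⟨x, hx⟩
    have h0 : (Fintype.card G) • (x : ULift.{u} ℤ) = 0 := by
      have : (trivZ G).ρ.norm x = (Fintype.card G) • (x : ULift.{u} ℤ) := by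
        simp [Representation.norm]
      rw [← this]
      exact hx
    apply Subtype.ext
    change x = (0 : ULift.{u} ℤ)
    have h1 := congrArg ULift.down h0
    rw [ULift.smul_down] at h1
    apply ULift.down_injective
    simpa using h1
  refine ⟨fun a b => ?_⟩
  obtain ⟨x, rfl⟩ := hsurj a
  obtain ⟨y, rfl⟩ := hsurj b
  rw [hker x, hker y]

theorem Quo.mk_eq_mk {A K L : Type u} [AddCommGroup A] [AddCommGroup K] [AddCommGroup L]
    {σ : A →+ K} {τ : A →+ L} (e : K ≃+ L) (hσ : Function.Surjective σ)
    (hτ : Function.Surjective τ) (h : ∀ a, e (σ a) = τ a) : Quo.mk σ hσ = Quo.mk τ hτ :=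
  Quotient.sound ⟨e, h⟩

/-! ### Differentials of cellular covers -/

namespace CellularCover

variable {G : Type u} [Group G] (c : CellularCover G)

theorem eq_one_of_hom_comp_eq_one (φ : c.carrier →* c.carrier) (h : ∀ x, c.hom (φ x) = 1)
    (x : c.carrier) : φ x = 1 := by
  have : φ = 1 := c.bijective.1 (MonoidHom.ext fun x => by simp [h])
  rw [this, MonoidHom.one_apply]

/-- The transfer to the centre, x ↦ x^[X:Z(X)], is a homomorphism. Its |G|-th power takes values in
the kernel of c, so it is trivial. -/
theorem exists_exponent [Finite G] :
    ∃ n ≠ 0, ∀ x : c.carrier, x ^ n = 1 := by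
  have h0 : c.hom.ker.index ≠ 0 := by
    rw [Subgroup.index_ker]
    exact Nat.card_pos.ne'
  have : (Subgroup.center c.carrier).FiniteIndex :=
    ⟨ne_zero_of_dvd_ne_zero h0 (Subgroup.index_dvd_of_le c.ker_le_center)⟩
  let t := MonoidHom.transferCenterPow c.carrier
  let φ : c.carrier →* c.carrier := MonoidHom.mk' (fun x => (t x : c.carrier) ^ Nat.card G)
    (fun x y => by
      rw [map_mul, Subgroup.coe_mul]
      exact Commute.mul_pow (Subgroup.mem_center_iff.1 (t y).2 _) _)
  have hφ : ∀ x, φ x = x ^ ((Subgroup.center c.carrier).index * Nat.card G) := fun x => by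
    simp [φ, t, pow_mul]
  refine ⟨_, mul_ne_zero this.index_ne_zero (Nat.card_pos (α := G)).ne', fun x => ?_⟩
  rw [← hφ]
  refine c.eq_one_of_hom_comp_eq_one φ (fun x => ?_) x
  rw [hφ, map_pow, pow_mul, pow_card_eq_one']

/-- The differential of a surjective cellular cover of a finite perfect group is surjective. -/
theorem differential_surjective_of_perfect [Finite G] (hG : commutator G = ⊤)
    (hc : Function.Surjective c.hom) :
    Function.Surjective (c.toCentralExtension hc).differential := by
  set E := c.toCentralExtension hc with hE
  obtain ⟨n, hn, hX⟩ := c.exists_exponent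
  rw [← AddMonoidHom.range_eq_top]
  by_contra hne
  obtain ⟨k, hk⟩ : ∃ k, k ∉ E.differential.range := by
    by_contra! h
    exact hne ((AddSubgroup.eq_top_iff' _).2 h)
  have hk' : (QuotientAddGroup.mk k : E.Kernel ⧸ E.differential.range) ≠ 0 := fun h =>
    hk ((QuotientAddGroup.eq_zero_iff _).1 h)
  obtain ⟨p, hp, u, b, hb⟩ := exists_hom_zmod_ne_zero hn (fun a => by
    obtain ⟨a, rfl⟩ := QuotientAddGroup.mk_surjective a
    refine (QuotientAddGroup.eq_zero_iff _).2 ?_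
    have : n • a = 0 := E.incl_injective (hX (E.incl a))
    change n • a ∈ _
    rw [this]
    exact zero_mem _) hk'
  obtain ⟨a, rfl⟩ := QuotientAddGroup.mk_surjective b
  obtain ⟨ψ, hψ⟩ := CentralExtension.exists_extend (E := E) hG
    (u.comp (QuotientAddGroup.mk' E.differential.range)) (fun a => by
      have : (QuotientAddGroup.mk (E.differential a) : E.Kernel ⧸ E.differential.range) = 0 :=
        (QuotientAddGroup.eq_zero_iff _).2 ⟨a, rfl⟩
      rw [AddMonoidHom.comp_apply, QuotientAddGroup.mk'_apply, this, map_zero])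
  have h1 := map_ker_eq_one_of_hom_zmod c.hom c.eq_one_of_hom_comp_eq_one hn hX hp ψ
    (E.hom_incl a)
  exact hb (Multiplicative.ofAdd.injective ((hψ a).symm.trans h1))

/-- A cellular cover of a group of prime order is injective. -/
theorem injective_of_prime_card {p : ℕ} (hp : p.Prime) (hcard : Nat.card G = p) : Function.Injective c.hom := by
  have := Fact.mk hp
  have : IsCyclic G := isCyclic_of_prime_card hcard
  -- A group with cyclic quotient by a central subgroup is abelian, so the p-th power is an
  -- endomorphism with values in the kernel, hence trivial.
  let : CommGroup c.carrier :=
    { (inferInstance : Group c.carrier) with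
      mul_comm :=
        (c.hom.isMulCommutative_of_isCyclic_of_ker_le_center c.ker_le_center).is_comm.comm }
  have hX : ∀ x : c.carrier, x ^ p = 1 := fun x =>
    c.eq_one_of_hom_comp_eq_one (powMonoidHom p) (fun x => by
      rw [powMonoidHom_apply, map_pow, ← hcard, pow_card_eq_one']) x
  rw [injective_iff_map_eq_one]
  intro x hx
  by_contra hne
  obtain ⟨u, hu⟩ := exists_hom_zmod_apply_ne_zero (p := p) (V := Additive c.carrier)
    (fun v => congrArg Additive.ofMul (hX v.toMul)) (v := Additive.ofMul x)
    (fun h => hne (Additive.ofMul.injective h))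
  exact hu (Multiplicative.ofAdd.injective (map_ker_eq_one_of_hom_zmod c.hom
    c.eq_one_of_hom_comp_eq_one hp.ne_zero hX hp (AddMonoidHom.toMultiplicativeRight u) hx))

theorem mk_differential_eq_of_equiv {c d : CellularCover G} (hc : Function.Surjective c.hom)
    (hd : Function.Surjective d.hom) (h : c ≈ d)
    (hμ : Function.Surjective (c.toCentralExtension hc).differential)
    (hν : Function.Surjective (d.toCentralExtension hd).differential) :
    Quo.mk _ hμ = Quo.mk _ hν := by
  obtain ⟨e, he⟩ := h
  let E := c.toCentralExtension hc
  let F := d.toCentralExtension hd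
  let θ : E.Kernel →+ F.Kernel := E.kerMap F e.toMonoidHom fun x hx => (he x).trans hx
  have hθ : Function.Bijective θ := by
    refine ⟨fun a b hab => E.incl_injective (e.injective (congrArg F.incl hab)), fun b => ?_⟩
    have hb : c.hom (e.symm (F.incl b)) = 1 :=
      (he _).symm.trans ((congrArg d.hom (e.apply_symm_apply _)).trans (F.hom_incl b))
    exact ⟨E.toKernel _ hb, F.incl_injective (e.apply_symm_apply _)⟩
  refine Quo.mk_eq_mk (AddEquiv.ofBijective θ hθ) _ _ fun a => ?_
  have := CentralExtension.differential_natural (E := E) (F := F) (MonoidHom.id G)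
    e.toMonoidHom he θ (fun _ => rfl) a
  rw [Schur.map_id] at this
  exact this.symm

/-- The class of the differential is invariant. -/
theorem mk_differential_mem_invQuot (hc : Function.Surjective c.hom)
    (hμ : Function.Surjective (c.toCentralExtension hc).differential) :
    Quo.mk _ hμ ∈ InvQuot G := by
  intro o
  obtain ⟨h, ho⟩ := QuotientGroup.mk_surjective (MulOpposite.unop o)
  have ho' : o = MulOpposite.op (QuotientGroup.mk h : Out G) := by rw [ho, MulOpposite.op_unop]
  rw [ho', outMulAction_mk]
  let E := c.toCentralExtension hc
  -- Lifts exist by surjectivity of φ ↦ cφ; by injectivity, lifts of inverse automorphisms are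
  -- inverse to each other.
  have hlift : ∀ k : MulAut G, ∃ φ : c.carrier →* c.carrier, ∀ x, c.hom (φ x) = k (c.hom x) :=
    fun k => (c.bijective.2 (k.toMonoidHom.comp c.hom)).imp fun φ hφ x => DFunLike.congr_fun hφ x
  have hinv : ∀ (k k' : MulAut G) (φ φ' : c.carrier →* c.carrier),
      (∀ x, c.hom (φ x) = k (c.hom x)) → (∀ x, c.hom (φ' x) = k' (c.hom x)) →
      (∀ g, k (k' g) = g) → ∀ x, φ (φ' x) = x := by
    intro k k' φ φ' hφ hφ' hk x
    have : φ.comp φ' = MonoidHom.id _ :=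
      c.bijective.1 (MonoidHom.ext fun x => by simp [hφ, hφ', hk])
    exact DFunLike.congr_fun this x
  obtain ⟨φ, hφ⟩ := hlift h
  obtain ⟨φ', hφ'⟩ := hlift h⁻¹
  have h1 := hinv h h⁻¹ φ φ' hφ hφ' h.apply_symm_apply
  have h2 := hinv h⁻¹ h φ' φ hφ' hφ h.symm_apply_apply
  let θ : E.Kernel →+ E.Kernel := E.kerMap E φ fun x hx =>
    (hφ x).trans ((congrArg h hx).trans (map_one h))
  let θ' : E.Kernel →+ E.Kernel := E.kerMap E φ' fun x hx =>
    (hφ' x).trans ((congrArg (fun g => (h⁻¹ : MulAut G) g) hx).trans (map_one (h⁻¹ : MulAut G)))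
  have hθ : Function.Bijective θ :=
    Function.bijective_iff_has_inverse.2 ⟨θ', fun k => E.incl_injective (h2 _),
      fun k => E.incl_injective (h1 _)⟩
  refine (Quo.mk_eq_mk (AddEquiv.ofBijective θ hθ) hμ _ fun a => ?_).symm
  exact (CentralExtension.differential_natural (E := E) (F := E) h.toMonoidHom φ hφ θ
    (fun _ => rfl) a).symm

/-- Surjective cellular covers of a perfect group with equivalent differentials are equivalent. -/
theorem equiv_of_mk_differential_eq (hG : commutator G = ⊤) {c d : CellularCover G}
    (hc : Function.Surjective c.hom) (hd : Function.Surjective d.hom)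
    (hμ : Function.Surjective (c.toCentralExtension hc).differential)
    (hν : Function.Surjective (d.toCentralExtension hd).differential)
    (h : Quo.mk _ hμ = Quo.mk _ hν) : c ≈ d := by
  let E := c.toCentralExtension hc
  let F := d.toCentralExtension hd
  obtain ⟨θ, hθ⟩ := Quotient.exact h
  change E.Kernel ≃+ F.Kernel at θ
  change ∀ a, θ (E.differential a) = F.differential a at hθ
  obtain ⟨φ, hφ, hφθ⟩ := CentralExtension.exists_lift (E := E) (F := F) hG (MonoidHom.id G)
    θ.toAddMonoidHom (fun a => by rw [Schur.map_id]; exact (hθ a).symm)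
  have hφ : ∀ x, F.hom (φ x) = E.hom x := hφ
  have hφθ : ∀ k, φ (E.incl k) = F.incl (θ k) := hφθ
  -- This is the short five lemma: φ is θ on kernels and the identity on G.
  have hbij : Function.Bijective φ := by
    constructor
    · rw [injective_iff_map_eq_one]
      intro x hx
      have hx1 : E.hom x = 1 := by rw [← hφ, hx, map_one]
      have h0 : θ (E.toKernel x hx1) = 0 := F.incl_injective (by
        rw [← hφθ, E.incl_toKernel, hx, F.incl_zero])
      rw [map_eq_zero_iff θ θ.injective] at h0
      exact congrArg E.incl h0
    · intro y
      obtain ⟨x, hx⟩ := E.surjective (F.hom y)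
      have hy : F.hom ((φ x)⁻¹ * y) = 1 := by rw [map_mul, map_inv, hφ, hx, inv_mul_cancel]
      refine ⟨x * E.incl (θ.symm (F.toKernel _ hy)), ?_⟩
      rw [map_mul, hφθ, AddEquiv.apply_symm_apply, F.incl_toKernel, mul_inv_cancel_left]
  exact ⟨MulEquiv.ofBijective φ hbij, hφ⟩

end CellularCover

/-! ### Cellularity of central extensions of simple groups -/

namespace CentralExtension

variable {G : Type u} [Group G] {E : CentralExtension G}

/-- A central extension of a perfect group with surjective differential is perfect. -/
theorem commutator_eq_top (hG : commutator G = ⊤) (hE : Function.Surjective E.differential) :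
    commutator E.carrier = ⊤ := by
  rw [Subgroup.eq_top_iff']
  have hker : ∀ x, E.hom x = 1 → x ∈ commutator E.carrier := by
    intro x hx
    obtain ⟨a, ha⟩ := hE (E.toKernel x hx)
    have := map_incl_differential (E := E) (B := Additive (Abelianization E.carrier))
      (Abelianization.of : E.carrier →* Abelianization E.carrier) a
    rw [ha] at this
    rw [← Abelianization.ker_of]
    exact this
  intro x
  have hmap : (commutator E.carrier).map E.hom = ⊤ := by
    rw [commutator_def, Subgroup.map_commutator, ← MonoidHom.range_eq_map,
      MonoidHom.range_eq_top.2 E.surjective, ← commutator_def, hG]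
  obtain ⟨y, hy, hyx⟩ := hmap.ge (Subgroup.mem_top (E.hom x))
  have := Subgroup.mul_mem _ (hker (x * y⁻¹) (by rw [map_mul, map_inv, hyx, mul_inv_cancel])) hy
  rwa [inv_mul_cancel_right] at this

/-- The quotient of two lifts is a homomorphism because the kernel is central, and a perfect group
has only the trivial homomorphism to an abelian group. -/
theorem eq_of_hom_comp_eq {X : Type*} [Group X]
    (hX : commutator X = ⊤) {φ φ' : X →* E.carrier} (h : ∀ x, E.hom (φ x) = E.hom (φ' x)) :
    φ = φ' := by
  have hx : ∀ x, E.hom (φ x * (φ' x)⁻¹) = 1 := fun x => by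
    rw [map_mul, map_inv, h, mul_inv_cancel]
  let δ : X →* Multiplicative E.Kernel := MonoidHom.mk'
    (fun x => Multiplicative.ofAdd (E.toKernel _ (hx x))) (fun x y => by
      rw [← ofAdd_add]
      congr 1
      apply E.incl_injective
      rw [incl_add, incl_toKernel, incl_toKernel, incl_toKernel, map_mul, map_mul]
      have := E.incl_mul_comm (E.toKernel _ (hx y)) (φ' x)⁻¹
      rw [incl_toKernel] at this
      rw [mul_assoc (φ x) (φ' x)⁻¹, ← this]
      group)
  ext x
  have : x ∈ δ.ker := Abelianization.commutator_subset_ker δ (hX ▸ Subgroup.mem_top x)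
  exact mul_inv_eq_one.1 (congrArg E.incl this)

/-- A nontrivial homomorphism from a perfect central extension of a finite simple group `G` to `G`
is the projection followed by an automorphism of `G`. -/
theorem exists_mulAut_of_ne_one [Finite G] [IsSimpleGroup G] (hE : commutator E.carrier = ⊤)
    (f : E.carrier →* G) (hf : f ≠ 1) : ∃ h : MulAut G, ∀ x, f x = h (E.hom x) := by
  have hle : f.ker ≤ E.hom.ker := by
    have hN : (f.ker.map E.hom).Normal := Subgroup.Normal.map inferInstance _ E.surjective
    rcases hN.eq_bot_or_eq_top with h | h
    · exact (Subgroup.map_eq_bot_iff _).1 h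
    -- Here the carrier is the product of ker f and the central kernel, so f has abelian image and
    -- is trivial by perfectness.
    · exfalso
      apply hf
      have hcomm : ∀ x y, f x * f y = f y * f x := by
        have hdec : ∀ x, ∃ k, f x = f (E.incl k) := by
          intro x
          obtain ⟨y, hy, hyx⟩ := h.ge (Subgroup.mem_top (E.hom x))
          have hk : E.hom (x * y⁻¹) = 1 := by rw [map_mul, map_inv, hyx, mul_inv_cancel]
          refine ⟨E.toKernel _ hk, ?_⟩
          rw [incl_toKernel, map_mul, map_inv, MonoidHom.mem_ker.1 hy, inv_one, mul_one]
        intro x y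
        obtain ⟨k, hk⟩ := hdec x
        rw [hk, ← map_mul, ← map_mul, incl_mul_comm]
      ext x
      have hxc : x ∈ commutator E.carrier := hE ▸ Subgroup.mem_top x
      have : commutator E.carrier ≤ f.ker := by
        rw [commutator_def, Subgroup.commutator_le]
        intro x _ y _
        rw [MonoidHom.mem_ker, map_commutatorElement, commutatorElement_eq_one_iff_mul_comm]
        exact hcomm x y
      exact this hxc
  -- Indices are compared because the carrier is not known to be finite: |G| divides the order of
  -- the image of f, which forces f to be onto with the same kernel as the projection.
  have hidx : E.hom.ker.index = Nat.card G := by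
    rw [Subgroup.index_ker, MonoidHom.range_eq_top.2 E.surjective, Subgroup.card_top]
  have hfidx : f.ker.index = Nat.card f.range := Subgroup.index_ker f
  have hdvd : Nat.card G ∣ Nat.card f.range := by
    rw [← hidx, ← hfidx]
    exact Subgroup.index_dvd_of_le hle
  have hcard : Nat.card f.range = Nat.card G := Nat.dvd_antisymm f.range.card_subgroup_dvd_card hdvd
  have hsurj : Function.Surjective f :=
    MonoidHom.range_eq_top.1 (Subgroup.eq_top_of_card_eq _ hcard)
  have hker : E.hom.ker = f.ker := by
    refine le_antisymm ?_ hle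
    rw [← Subgroup.relIndex_eq_one]
    have := Subgroup.relIndex_mul_index hle
    rw [hidx, hfidx, hcard] at this
    exact Nat.eq_of_mul_eq_mul_right (Nat.card_pos (α := G)) (by rw [this, one_mul])
  refine ⟨(QuotientGroup.quotientKerEquivOfSurjective E.hom E.surjective).symm.trans
    ((QuotientGroup.quotientMulEquivOfEq hker).trans
      (QuotientGroup.quotientKerEquivOfSurjective f hsurj)), fun x => ?_⟩
  have : (QuotientGroup.quotientKerEquivOfSurjective E.hom E.surjective).symm (E.hom x) =
      QuotientGroup.mk x := by
    rw [MulEquiv.symm_apply_eq]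
    rfl
  rw [MulEquiv.trans_apply, this]
  rfl

/-- A central extension of a finite perfect simple group is cellular if its differential is
surjective and has invariant kernel. -/
theorem bijective_hom_comp [Finite G] [IsSimpleGroup G] (hG : commutator G = ⊤)
    (hE : Function.Surjective E.differential)
    (hinv : ∀ h : MulAut G, ∃ θ : E.Kernel →+ E.Kernel,
      ∀ a, E.differential (Schur.map h.toMonoidHom a) = θ (E.differential a)) :
    Function.Bijective fun φ : E.carrier →* E.carrier => E.hom.comp φ := by
  have hX := commutator_eq_top hG hE
  refine ⟨fun φ φ' h => eq_of_hom_comp_eq hX (DFunLike.congr_fun h), fun f => ?_⟩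
  by_cases hf : f = 1
  · exact ⟨1, by ext; simp [hf]⟩
  · obtain ⟨h, hh⟩ := exists_mulAut_of_ne_one hX f hf
    obtain ⟨θ, hθ⟩ := hinv h
    obtain ⟨φ, hφ, -⟩ := exists_lift (E := E) (F := E) hG h.toMonoidHom θ hθ
    exact ⟨φ, MonoidHom.ext fun x => (hφ x).trans (hh x).symm⟩

end CentralExtension

/-! ### The classification for finite simple groups -/

theorem exists_cover_of_mem_invQuot {G : Type u} [Group G] [Finite G] [IsSimpleGroup G]
    (hG : commutator G = ⊤) {q : Quo (Schur G)} (hq : q ∈ InvQuot G) :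
    ∃ (c : CellularCover G) (hc : Function.Surjective c.hom)
      (hμ : Function.Surjective (c.toCentralExtension hc).differential), Quo.mk _ hμ = q := by
  induction q using Quotient.inductionOn with
  | h σ =>
    obtain ⟨E, e, he⟩ := CentralExtension.exists_differential_eq hG σ.hom
    have hE : Function.Surjective E.differential := fun k => by
      obtain ⟨a, ha⟩ := σ.surjective (e.symm k)
      exact ⟨a, by rw [he, ha, AddEquiv.apply_symm_apply]⟩
    have hbij := CentralExtension.bijective_hom_comp hG hE fun h => by
      -- Invariance under h gives θ with θ ∘ σ = σ ∘ H₂(h), which is then transported along e to the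
      -- kernel of E.
      obtain ⟨θ, hθ⟩ := Quotient.exact (hq (MulOpposite.op (QuotientGroup.mk h : Out G))).symm
      refine ⟨(e.toAddMonoidHom.comp θ.toAddMonoidHom).comp e.symm.toAddMonoidHom, fun a => ?_⟩
      have h1 : θ (σ.hom a) = σ.hom (Schur.map h.toMonoidHom a) := hθ a
      rw [he, he, ← h1]
      simp
    exact ⟨⟨E.carrier, E.hom, hbij⟩, E.surjective, hE,
      Quotient.sound ⟨e.symm, fun a => by
        change e.symm (E.differential a) = _
        rw [he, AddEquiv.symm_apply_apply]⟩⟩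

theorem IsSimpleGroup.commutator_eq_top_or_prime_card (G : Type u) [Group G] [Finite G]
    [IsSimpleGroup G] :
    commutator G = ⊤ ∨ (Nat.card G).Prime ∧ Subsingleton (Schur G) := by
  have hN : (commutator G).Normal := inferInstance
  rcases hN.eq_bot_or_eq_top with h | h
  · right
    let : CommGroup G :=
      { ‹Group G› with
        mul_comm := fun x y => by
          rw [← commutatorElement_eq_one_iff_mul_comm, ← Subgroup.mem_bot, ← h]
          exact Subgroup.commutator_mem_commutator (Subgroup.mem_top x) (Subgroup.mem_top y) }
    exact ⟨IsSimpleGroup.prime_card, schur_subsingleton_of_isCyclic G⟩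
  · exact Or.inl h

/-- The identity as a cellular cover. -/
def CellularCover.refl (G : Type u) [Group G] : CellularCover G where
  carrier := G
  hom := MonoidHom.id G
  bijective := by
    simp only [MonoidHom.id_comp]
    exact Function.bijective_id

theorem CellularCover.subsingleton_kernel {G : Type u} [Group G] (c : CellularCover G)
    (hc : Function.Surjective c.hom) (hi : Function.Injective c.hom) :
    Subsingleton (c.toCentralExtension hc).Kernel :=
  ⟨fun a b => (c.toCentralExtension hc).incl_injective (hi
    (((c.toCentralExtension hc).hom_incl a).trans ((c.toCentralExtension hc).hom_incl b).symm))⟩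

/-- The differential classifies the surjective cellular covers of a finite simple group. -/
theorem exists_bijective_differential (G : Type u) [Group G] [Finite G] [IsSimpleGroup G] :
    ∃ Φ : SurCov G → InvQuot G,
      Function.Bijective Φ ∧
      ∀ (c : CellularCover G) (hc : Function.Surjective c.hom),
        ∃ hμ : Function.Surjective (c.toCentralExtension hc).differential,
          (Φ ⟨Cov.mk c, c, hc, rfl⟩ : Quo (Schur G)) =
            Quo.mk (c.toCentralExtension hc).differential hμ := by
  have hsub : (Nat.card G).Prime → ∀ (c : CellularCover G) (hc : Function.Surjective c.hom),
      Subsingleton (c.toCentralExtension hc).Kernel := fun hp c hc =>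
    c.subsingleton_kernel hc (c.injective_of_prime_card hp rfl)
  have hsurj : ∀ (c : CellularCover G) (hc : Function.Surjective c.hom),
      Function.Surjective (c.toCentralExtension hc).differential := by
    intro c hc
    rcases IsSimpleGroup.commutator_eq_top_or_prime_card G with hG | ⟨hp, -⟩
    · exact c.differential_surjective_of_perfect hG hc
    · have := hsub hp c hc
      exact Function.surjective_to_subsingleton _
  -- Φ is defined through chosen representatives; `hΦ` shows that the choice does not matter.
  choose C hC hCq using fun q : SurCov G => q.2
  let Φ : SurCov G → InvQuot G := fun q =>
    ⟨Quo.mk _ (hsurj (C q) (hC q)), (C q).mk_differential_mem_invQuot (hC q) _⟩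
  have hΦ : ∀ (c : CellularCover G) (hc : Function.Surjective c.hom),
      (Φ ⟨Cov.mk c, c, hc, rfl⟩ : Quo (Schur G)) = Quo.mk _ (hsurj c hc) := fun c hc =>
    CellularCover.mk_differential_eq_of_equiv _ hc (Quotient.exact (hCq ⟨Cov.mk c, c, hc, rfl⟩))
      _ _
  refine ⟨Φ, ⟨?_, ?_⟩, fun c hc => ⟨hsurj c hc, hΦ c hc⟩⟩
  · rintro ⟨_, c, hc, rfl⟩ ⟨_, d, hd, rfl⟩ h
    have h1 := congrArg Subtype.val h
    rw [hΦ c hc, hΦ d hd] at h1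
    refine Subtype.ext (Quotient.sound ?_)
    rcases IsSimpleGroup.commutator_eq_top_or_prime_card G with hG | ⟨hp, -⟩
    · exact CellularCover.equiv_of_mk_differential_eq hG hc hd _ _ h1
    · let e := MulEquiv.ofBijective c.hom ⟨c.injective_of_prime_card hp rfl, hc⟩
      let e' := MulEquiv.ofBijective d.hom ⟨d.injective_of_prime_card hp rfl, hd⟩
      exact ⟨e.trans e'.symm, fun x => e'.apply_symm_apply (e x)⟩
  · rintro ⟨q, hq⟩
    rcases IsSimpleGroup.commutator_eq_top_or_prime_card G with hG | ⟨hp, hS⟩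
    · obtain ⟨c, hc, hμ, rfl⟩ := exists_cover_of_mem_invQuot hG hq
      exact ⟨⟨Cov.mk c, c, hc, rfl⟩, Subtype.ext (hΦ c hc)⟩
    · have hid : Function.Surjective (CellularCover.refl G).hom := Function.surjective_id
      refine ⟨⟨Cov.mk (CellularCover.refl G), _, hid, rfl⟩, Subtype.ext ((hΦ _ hid).trans ?_)⟩
      induction q using Quotient.inductionOn with
      | h σ =>
        have := hsub hp _ hid
        have hσ : Subsingleton σ.target := σ.surjective.subsingleton
        exact Quotient.sound ⟨⟨⟨fun _ => 0, fun _ => 0, fun _ => Subsingleton.elim _ _,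
          fun _ => Subsingleton.elim _ _⟩, fun _ _ => Subsingleton.elim _ _⟩,
          fun _ => Subsingleton.elim _ _⟩

end CellCover

end

theorem mainTheorem6 (G : Type u) [Group G] [Finite G] [IsSimpleGroup G] :
    ∃ Φ : CellCover.SurCov G → CellCover.InvQuot G,
      Function.Bijective Φ ∧
      ∀ (c : CellCover.CellularCover G) (hc : Function.Surjective c.hom),
        ∃ hμ : Function.Surjective (c.toCentralExtension hc).differential,
          (Φ ⟨CellCover.Cov.mk c, c, hc, rfl⟩ : CellCover.Quo (CellCover.Schur G)) =
            CellCover.Quo.mk (c.toCentralExtension hc).differential hμ :=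
  CellCover.exists_bijective_differential G
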